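/- Let $(\Omega,\mathcal F,\mathbb P)$ be a probability space, $(X,d)$ a complete separable metric space with its Borel $\sigma$-field, and $\mathcal R(X)$ the set of $X$-valued random variables on $\Omega$; $\mathcal L(\xi)$ denotes the law of $\xi\in\mathcal R(X)$. For an approach structure on $\mathcal R(X)$ with distance $\delta:\mathcal R(X)\times 2^{\mathcal R(X)}\to[0,\infty]$, its limit operator at a sequence is $$\lambda(\xi_n\to\xi)=\sup\{\delta(\xi,\Gamma)\mid \Gamma\subseteq\mathcal R(X),\ \xi_n\in\Gamma\text{ for infinitely many }n\}.$$ Let $\lambda_{w}$ be the limit operator of the weak approach structure $\mathcal A_w$, with distance $$\delta_w(\xi,\Gamma)=\sup_{F}\inf_{\eta\in\Gamma}\max_{f\in F}\Bigl|\int f\,d\mathcal L(\xi)-\int f\,d\mathcal L(\eta)\Bigr|,$$ where $F$ ranges over the finite sets of continuous functions $X\to[0,1]$ (the maximum over $F=\emptyset$ being $0$), and let $\lambda_{\mathbb P}$ be the limit operator of the approach structure of convergence in probability $\mathcal A_{\mathbb P}$, with distance $$\delta_{\mathbb P}(\xi,\Gamma)=\sup_{a>0}\inf_{\eta\in\Gamma}\mathbb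 P[d(\xi,\eta)\ge a].$$ (An infimum over the empty set is $\infty$.) Then for all $\xi\in\mathcal R(X)$ and all sequences $(\xi_n)_n$ in $\mathcal R(X)$ $$\lambda_w(\xi_n\to\xi)\le\inf\lambda_{\mathbb P}(\xi_n'\to\xi'),$$ the infimum being taken over all $\xi'\in\mathcal R(X)$ and all sequences $(\xi_n')_n$ in $\mathcal R(X)$ such that $\mathcal L(\xi')=\mathcal L(\xi)$ and $\mathcal L(\xi_n')=\mathcal L(\xi_n)$ for all $n$. Here $\mathcal A_{\mathbb P}$ is the approach structure underlying the uniform gauge $\mathcal G_K$ with basis the Ky Fan metrics $$K_\ell(\xi,\eta)=\inf\{\epsilon>0\mid\mathbb P[d(\xi,\eta)\ge \ell\epsilon]<\epsilon\}\qquad(\ell>0),$$ and $\mathcal A_w$ is the approach structure underlying the uniform gauge $\mathcal G_P$ with basis the Prokhorov metrics $$\rho_\ell(\xi,\eta)=\inf\{\epsilon>0\mid\forall A\in\mathcal B_X:\ \mathcal L(\xi)[A]\le\mathcal L(\eta)[A^{(\ell\epsilon)}]+\epsilon\},\quad A^{(r)}=\{x\mid\inf_{a\in A}d(x,a)\le r\}\qquad(\ell>0).$$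 (The uniform gauge with basis $\mathcal B$ consists of all possibly infinite, not necessarily separated metrics $e$ such that for all $\epsilon>0$, $\omega<\infty$ there is $b\in\mathcal B$ with $e\wedge\omega\le b+\epsilon$; the distance of the approach structure underlying a uniform gauge $\mathcal G$ is $\delta(\xi,\Gamma)=\sup_{e\in\mathcal G}\inf_{\eta\in\Gamma}e(\xi,\eta)$.) -/

import Mathlib

open MeasureTheory Filter Set
open scoped ENNReal NNReal

noncomputable section

/-! ## Approach structures and uniform gauges -/

/-- An approach structure on `E`, given by its distance `δ : E × 2^E → [0,∞]`. -/
@[ext]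
structure ApproachStructure (E : Type*) where
  /-- The distance from a point to a set. -/
  δ : E → Set E → ℝ≥0∞
  δ_self : ∀ x, δ x {x} = 0
  δ_empty : ∀ x, δ x ∅ = ⊤
  δ_union : ∀ x A B, δ x (A ∪ B) = min (δ x A) (δ x B)
  δ_enlarge : ∀ x A (ε : ℝ≥0∞), δ x A ≤ δ x {y | δ y A ≤ ε} + ε

/-- The limit operator of an approach structure: `λ ℱ (x)` is the supremum of `δ (x, A)` over all
`A` in `sec ℱ`, i.e. over all `A` that meet every member of the filter `ℱ`. -/
def ApproachStructure.limitOp {E : Type*} (𝒜 : ApproachStructure E) (ℱ : Filter E) (x : E) :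
    ℝ≥0∞ :=
  ⨆ (A : Set E) (_ : ∀ F ∈ ℱ, (A ∩ F).Nonempty), 𝒜.δ x A

/-- `λ (x_n → x)`: the limit operator at the filter generated by the tails of a sequence. -/
def ApproachStructure.seqLimitOp {E : Type*} (𝒜 : ApproachStructure E) (u : ℕ → E) (x : E) :
    ℝ≥0∞ :=
  𝒜.limitOp (Filter.map u atTop) x

/-- The approach structure generated by a family of functions `φ i : E × E → [0,∞]` which vanish
on the diagonal, are directed upwards and satisfy a (mixed) triangle inequality:
`δ (x, A) = sup_i inf_{a ∈ A} φ i (x, a)`. -/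
def ApproachStructure.ofFamily {E ι : Type*} [Nonempty ι] (φ : ι → E → E → ℝ≥0∞)
    (hrefl : ∀ i x, φ i x x = 0)
    (hdir : ∀ i j, ∃ k, ∀ x y, φ i x y ≤ φ k x y ∧ φ j x y ≤ φ k x y)
    (htri : ∀ i, ∃ j, ∀ x y z, φ i x z ≤ φ j x y + φ j y z) : ApproachStructure E where
  δ x A := ⨆ i, ⨅ a ∈ A, φ i x a
  δ_self x := by simp [hrefl]
  δ_empty x := by simp
  δ_union x A B := by
    apply le_antisymm
    · exact le_min (iSup_mono fun i => biInf_mono fun a ha => Or.inl ha)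
        (iSup_mono fun i => biInf_mono fun a ha => Or.inr ha)
    · refine le_of_forall_lt fun c hc => ?_
      obtain ⟨h1, h2⟩ := lt_min_iff.1 hc
      obtain ⟨i, hi⟩ := lt_iSup_iff.1 h1
      obtain ⟨j, hj⟩ := lt_iSup_iff.1 h2
      obtain ⟨k, hk⟩ := hdir i j
      refine lt_of_lt_of_le (lt_min hi hj) (le_iSup_of_le k ?_)
      refine le_iInf₂ fun a ha => ?_
      rcases ha with ha | ha
      · exact (min_le_left _ _).trans ((iInf₂_le a ha).trans (hk x a).1)
      · exact (min_le_right _ _).trans ((iInf₂_le a ha).trans (hk x a).2)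
  δ_enlarge x A ε := by
    refine iSup_le fun i => ?_
    obtain ⟨j, hj⟩ := htri i
    refine le_trans ?_ (add_le_add_left (le_iSup
      (fun j => ⨅ y ∈ {y | ⨆ i, ⨅ a ∈ A, φ i y a ≤ ε}, φ j x y) j) ε)
    simp only [ENNReal.iInf_add]
    refine le_iInf₂ fun y hy => ?_
    have hy' : ⨅ a ∈ A, φ j y a ≤ ε :=
      (le_iSup (fun i => ⨅ a ∈ A, φ i y a) j).trans hy
    refine le_trans ?_ (add_le_add_right hy' (φ j x y))
    simp only [ENNReal.add_iInf]
    exact le_iInf₂ fun a ha => (iInf₂_le a ha).trans (hj x y a)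

/-- A metric in the sense of approach theory: possibly infinite, not necessarily separated. -/
structure IsExtMetric {E : Type*} (d : E → E → ℝ≥0∞) : Prop where
  refl : ∀ x, d x x = 0
  symm : ∀ x y, d x y = d y x
  triangle : ∀ x y z, d x z ≤ d x y + d y z

/-- `d` is dominated by the collection `𝒢`: for all `ε > 0` and `ω < ∞` there is `e ∈ 𝒢` such that
`d ∧ ω ≤ e + ε`. -/
def IsDominatedBy {E : Type*} (d : E → E → ℝ≥0∞) (𝒢 : Set (E → E → ℝ≥0∞)) : Prop :=
  ∀ ε ω : ℝ≥0, 0 < ε → ∃ e ∈ 𝒢, ∀ x y, min (d x y) ω ≤ e x y + ε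

/-- A uniform gauge on `E`: an (upwards directed, non-empty) collection of metrics that contains
every metric that it dominates. -/
structure UniformGauge (E : Type*) where
  /-- The metrics in the gauge. -/
  metrics : Set (E → E → ℝ≥0∞)
  isExtMetric : ∀ d ∈ metrics, IsExtMetric d
  nonempty : metrics.Nonempty
  directed : ∀ d ∈ metrics, ∀ e ∈ metrics, ∃ f ∈ metrics, ∀ x y, d x y ≤ f x y ∧ e x y ≤ f x y
  saturated : ∀ d, IsExtMetric d → IsDominatedBy d metrics → d ∈ metrics

/-- The uniform gauge with a given (directed) basis `ℬ`: all metrics dominated by `ℬ`. -/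
def UniformGauge.ofBasis {E : Type*} (ℬ : Set (E → E → ℝ≥0∞)) (hne : ℬ.Nonempty)
    (hdir : ∀ d ∈ ℬ, ∀ e ∈ ℬ, ∃ f ∈ ℬ, ∀ x y, d x y ≤ f x y ∧ e x y ≤ f x y) :
    UniformGauge E where
  metrics := {d | IsExtMetric d ∧ IsDominatedBy d ℬ}
  isExtMetric d hd := hd.1
  nonempty := by
    obtain ⟨b, hb⟩ := hne
    exact ⟨fun _ _ => 0, ⟨by simp, by simp, by simp⟩, fun ε ω _ => ⟨b, hb, by simp⟩⟩
  directed d hd e he := by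
    refine ⟨fun x y => max (d x y) (e x y), ⟨⟨?_, ?_, ?_⟩, ?_⟩,
      fun x y => ⟨le_max_left _ _, le_max_right _ _⟩⟩
    · intro x
      simp [hd.1.refl, he.1.refl]
    · intro x y
      simp only [hd.1.symm x y, he.1.symm x y]
    · intro x y z
      exact max_le
        ((hd.1.triangle x y z).trans (add_le_add (le_max_left _ _) (le_max_left _ _)))
        ((he.1.triangle x y z).trans (add_le_add (le_max_right _ _) (le_max_right _ _)))
    · intro ε ω hε
      obtain ⟨b, hb, h1⟩ := hd.2 ε ω hε
      obtain ⟨c, hc, h2⟩ := he.2 ε ω hε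
      obtain ⟨f, hf, h3⟩ := hdir b hb c hc
      refine ⟨f, hf, fun x y => ?_⟩
      rw [min_max_distrib_right]
      exact max_le ((h1 x y).trans (add_le_add_left (h3 x y).1 _))
        ((h2 x y).trans (add_le_add_left (h3 x y).2 _))
  saturated d hd h := by
    refine ⟨hd, fun ε ω hε => ?_⟩
    obtain ⟨e, he, h1⟩ := h (ε / 2) ω (half_pos hε)
    obtain ⟨b, hb, h2⟩ := he.2 (ε / 2) ω (half_pos hε)
    refine ⟨b, hb, fun x y => ?_⟩
    have h3 : min (d x y) (ω : ℝ≥0∞) ≤ min (e x y) ω + (ε / 2 : ℝ≥0) := by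
      rw [min_add]
      exact le_min (h1 x y) ((min_le_right _ _).trans le_self_add)
    refine h3.trans ((add_le_add_left (h2 x y) _).trans (le_of_eq ?_))
    rw [add_assoc, ← ENNReal.coe_add, add_halves]

/-- The approach structure underlying a uniform gauge: `δ (x, A) = sup_{d ∈ 𝒢} inf_{a ∈ A} d (x, a)`. -/
def UniformGauge.toApproach {E : Type*} (𝒢 : UniformGauge E) : ApproachStructure E :=
  haveI : Nonempty 𝒢.metrics := 𝒢.nonempty.to_subtype
  ApproachStructure.ofFamily (fun d : 𝒢.metrics => d.1)
    (fun d => (𝒢.isExtMetric d.1 d.2).refl)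
    (fun d e =>
      let ⟨f, hf, h⟩ := 𝒢.directed d.1 d.2 e.1 e.2
      ⟨⟨f, hf⟩, h⟩)
    (fun d => ⟨d, (𝒢.isExtMetric d.1 d.2).triangle⟩)

/-! ## Random variables -/

/-- The set `ℛ(X)` of `X`-valued random variables on `Ω`. -/
abbrev RandomVar (Ω X : Type*) [MeasurableSpace Ω] [MeasurableSpace X] : Type _ :=
  {ξ : Ω → X // Measurable ξ}

section

variable {Ω : Type*} [MeasurableSpace Ω] (P : Measure Ω)
variable (X : Type*) [MetricSpace X] [MeasurableSpace X]

/-- The law of a random variable. -/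
def RandomVar.law {X : Type*} [MeasurableSpace X] (ξ : RandomVar Ω X) : Measure X :=
  P.map ξ.1

/-- The approach structure of convergence in probability, with distance
`δ (ξ, Γ) = sup_{a > 0} inf_{η ∈ Γ} P[d(ξ, η) ≥ a]`. -/
def convInProbApproach : ApproachStructure (RandomVar Ω X) :=
  haveI : Nonempty {a : ℝ // 0 < a} := ⟨⟨1, one_pos⟩⟩
  ApproachStructure.ofFamily
    (fun (a : {a : ℝ // 0 < a}) (ξ η : RandomVar Ω X) => P {ω | a.1 ≤ dist (ξ.1 ω) (η.1 ω)})
    (fun a ξ => by simp [not_le.2 a.2])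
    (fun a b => ⟨⟨min a.1 b.1, lt_min a.2 b.2⟩, fun ξ η =>
      ⟨measure_mono fun ω (h : a.1 ≤ _) => show min a.1 b.1 ≤ _ from (min_le_left _ _).trans h,
        measure_mono fun ω (h : b.1 ≤ _) => show min a.1 b.1 ≤ _ from (min_le_right _ _).trans h⟩⟩)
    (fun a => ⟨⟨a.1 / 2, half_pos a.2⟩, fun ξ η ζ => by
      refine le_trans (measure_mono fun ω h => ?_) (measure_union_le _ _)
      by_contra hc
      simp only [mem_union, mem_ofPred_eq, not_or, not_le] at hc h
      linarith [dist_triangle (ξ.1 ω) (η.1 ω) (ζ.1 ω)]⟩)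

/-- The weak approach structure: the initial structure for the maps `ξ ↦ ∫ f dℒ(ξ) ∈ [0,1]`,
`f` ranging over the continuous functions `X → [0,1]`, i.e. with distance
`δ (ξ, Γ) = sup_F inf_{η ∈ Γ} max_{f ∈ F} |∫ f dℒ(ξ) - ∫ f dℒ(η)|`, `F` ranging over the finite
sets of such functions. -/
def weakApproach : ApproachStructure (RandomVar Ω X) :=
  ApproachStructure.ofFamily
    (fun (F : Finset C(X, unitInterval)) (ξ η : RandomVar Ω X) =>
      ⨆ f ∈ F, ENNReal.ofReal |(∫ x, (f x : ℝ) ∂(ξ.law P)) - ∫ x, (f x : ℝ) ∂(η.law P)|)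
    (fun F ξ => by simp)
    (fun F G => by
      classical
      exact ⟨F ∪ G, fun ξ η => ⟨biSup_mono fun f hf => Finset.mem_union_left _ hf,
        biSup_mono fun f hf => Finset.mem_union_right _ hf⟩⟩)
    (fun F => ⟨F, fun ξ η ζ => iSup₂_le fun f hf => by
      refine le_trans ((ENNReal.ofReal_le_ofReal (abs_sub_le _ _ _)).trans ENNReal.ofReal_add_le)
        (add_le_add (le_iSup₂_of_le f hf le_rfl) (le_iSup₂_of_le f hf le_rfl))⟩)

variable {X}

/-- The Ky Fan metric `K_l(ξ, η) = inf {ε > 0 | P[d(ξ, η) ≥ l ε] < ε}`. -/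
def kyFan (l : ℝ) (ξ η : RandomVar Ω X) : ℝ≥0∞ :=
  sInf {t | ∃ ε : ℝ, 0 < ε ∧ P {ω | l * ε ≤ dist (ξ.1 ω) (η.1 ω)} < ENNReal.ofReal ε ∧
    t = ENNReal.ofReal ε}

/-- The Prokhorov metric
`ρ_l(ξ, η) = inf {ε > 0 | ∀ A Borel, ℒ(ξ)[A] ≤ ℒ(η)[A^(l ε)] + ε}`, where
`A^(r) = {x | inf_{a ∈ A} d(x, a) ≤ r}` (empty if `A` is). -/
def prokhorov (l : ℝ) (ξ η : RandomVar Ω X) : ℝ≥0∞ :=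
  sInf {t | ∃ ε : ℝ, 0 < ε ∧ (∀ A : Set X, MeasurableSet A →
    ξ.law P A ≤ η.law P (Metric.cthickening (l * ε) A) + ENNReal.ofReal ε) ∧
    t = ENNReal.ofReal ε}

lemma kyFan_anti {l m : ℝ} (h : l ≤ m) (ξ η : RandomVar Ω X) : kyFan P m ξ η ≤ kyFan P l ξ η := by
  apply sInf_le_sInf
  rintro t ⟨ε, hε, h1, rfl⟩
  exact ⟨ε, hε, (measure_mono fun ω hω =>
    (mul_le_mul_of_nonneg_right h hε.le).trans hω).trans_lt h1, rfl⟩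

lemma prokhorov_anti {l m : ℝ} (h : l ≤ m) (ξ η : RandomVar Ω X) :
    prokhorov P m ξ η ≤ prokhorov P l ξ η := by
  apply sInf_le_sInf
  rintro t ⟨ε, hε, h1, rfl⟩
  exact ⟨ε, hε, fun A hA => (h1 A hA).trans (add_le_add_left (measure_mono
    (Metric.cthickening_mono (mul_le_mul_of_nonneg_right h hε.le) A)) _), rfl⟩

variable (X)

/-- The Ky Fan uniform gauge, with basis `{K_l | l > 0}`. -/
def kyFanGauge : UniformGauge (RandomVar Ω X) :=
  UniformGauge.ofBasis {d | ∃ l : ℝ, 0 < l ∧ d = kyFan P l} ⟨_, 1, one_pos, rfl⟩ (by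
    rintro _ ⟨l, hl, rfl⟩ _ ⟨m, hm, rfl⟩
    exact ⟨_, ⟨min l m, lt_min hl hm, rfl⟩, fun ξ η =>
      ⟨kyFan_anti P (min_le_left _ _) ξ η, kyFan_anti P (min_le_right _ _) ξ η⟩⟩)

/-- The Prokhorov uniform gauge, with basis `{ρ_l | l > 0}`. -/
def prokhorovGauge : UniformGauge (RandomVar Ω X) :=
  UniformGauge.ofBasis {d | ∃ l : ℝ, 0 < l ∧ d = prokhorov P l} ⟨_, 1, one_pos, rfl⟩ (by
    rintro _ ⟨l, hl, rfl⟩ _ ⟨m, hm, rfl⟩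
    exact ⟨_, ⟨min l m, lt_min hl hm, rfl⟩, fun ξ η =>
      ⟨prokhorov_anti P (min_le_left _ _) ξ η, prokhorov_anti P (min_le_right _ _) ξ η⟩⟩)

end

end

/-!
The distances of all four approach structures have the form `δ(ξ, Γ) = sup_i inf_{η ∈ Γ} φ_i(ξ, η)`;
for the two gauges this uses that the Ky Fan and Prokhorov metrics really are metrics, so that they
belong to the gauges they generate (`UniformGauge.toApproach_ofBasis_δ`). Such distances are compared
by `iSup_biInf_le_iSup_biInf`: it suffices to bound each `φ_i` at the point `ξ`, below each level `c`.

For convergence in probability, `P[d(ξ, η) ≥ a] < c` and `K_l(ξ, η) < c` match when `a = l c`.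

For the weak structure, `ρ_l(ξ, η) < c` gives `ℒ(ξ)[A] ≤ ℒ(η)[A^(r)] + c` for `r = l c`. If `f` were
uniformly continuous, the layer cake formula would turn this into a bound for the difference of the
integrals of `f`; in general `f` oscillates little at a small enough scale `r` outside a set of small
`ℒ(ξ)`-measure, which is enough because `ξ` is fixed while `η` varies
(`eventually_integral_le_of_cthickening`). Conversely, by separability finitely many small balls carry
almost all of `ℒ(ξ)`, and the bump functions of the finitely many unions of these balls control
`ℒ(ξ)[A]` for all `A` at once (`exists_finset_forall_measure_le_cthickening`).

Now `ρ_l ≤ K_l` yields `δ_w ≤ δ_P`. A set `Γ` that contains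
infinitely many `ξ_n` may be shrunk to the set of these `ξ_n`, which only increases `δ_w(ξ, Γ)`, and
then, as `δ_w` depends on the laws alone, replaced by the set of the corresponding `ξ_n'`. The
inequality between the limit operators follows.
-/

open Topology

/-! ### Comparing distances of the form `sup inf` -/

/-- Two distances of the form `sup inf` are compared one member of the family at a time, and only
below a given level `c`. The parameter of `ψ` may depend on `c`, which is how the metrics `K_l` and
`ρ_l`, whose arguments enter through `l ε`, are matched with thresholds that do not scale. -/
theorem iSup_biInf_le_iSup_biInf {E ι κ : Type*} {φ : ι → E → ℝ≥0∞} {ψ : κ → E → ℝ≥0∞}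
    (h : ∀ i (c ε : ℝ), 0 < c → 0 < ε →
      ∃ j, ∀ a, ψ j a < ENNReal.ofReal c → φ i a ≤ ENNReal.ofReal (c + ε)) (A : Set E) :
    ⨆ i, ⨅ a ∈ A, φ i a ≤ ⨆ j, ⨅ a ∈ A, ψ j a := by
  refine iSup_le fun i => ENNReal.le_of_forall_pos_le_add fun ε hε hfin => ?_
  set s := ⨆ j, ⨅ a ∈ A, ψ j a with hs
  have hε' : (0 : ℝ) < ε / 2 := half_pos hε
  obtain ⟨j, hj⟩ := h i (s.toReal + ε / 2) (ε / 2)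
    (add_pos_of_nonneg_of_pos ENNReal.toReal_nonneg hε') hε'
  have hlt : ⨅ a ∈ A, ψ j a < ENNReal.ofReal (s.toReal + ε / 2) := by
    refine (le_iSup (fun j => ⨅ a ∈ A, ψ j a) j).trans_lt ?_
    rw [← hs, ENNReal.lt_ofReal_iff_toReal_lt hfin.ne]
    linarith
  obtain ⟨a, ha⟩ := iInf_lt_iff.1 hlt
  obtain ⟨haA, ha⟩ := iInf_lt_iff.1 ha
  refine (iInf₂_le a haA).trans ((hj a ha).trans (le_of_eq ?_))
  rw [add_assoc, add_halves, ENNReal.ofReal_add ENNReal.toReal_nonneg ε.coe_nonneg,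
    ENNReal.ofReal_toReal hfin.ne, ENNReal.ofReal_coe_nnreal]

/-- If the members of a basis are metrics, they belong to the gauge, so that the distance of the
underlying approach structure is computed by the basis alone. -/
theorem UniformGauge.toApproach_ofBasis_δ {E ι : Type*} {b : ι → E → E → ℝ≥0∞}
    {ℬ : Set (E → E → ℝ≥0∞)} (hℬ : ∀ d, d ∈ ℬ ↔ ∃ i, d = b i) (hb : ∀ i, IsExtMetric (b i))
    (hne : ℬ.Nonempty)
    (hdir : ∀ d ∈ ℬ, ∀ e ∈ ℬ, ∃ f ∈ ℬ, ∀ x y, d x y ≤ f x y ∧ e x y ≤ f x y)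
    (x : E) (A : Set E) :
    (UniformGauge.ofBasis ℬ hne hdir).toApproach.δ x A = ⨆ i, ⨅ a ∈ A, b i x a := by
  apply le_antisymm
  · refine iSup_biInf_le_iSup_biInf
      (φ := fun (d : (UniformGauge.ofBasis ℬ hne hdir).metrics) a => d.1 x a) ?_ A
    rintro ⟨d, hd, hdom⟩ c ε hc hε
    obtain ⟨e, he, h⟩ := hdom ⟨ε, hε.le⟩ ⟨c + 2 * ε, by positivity⟩ hε
    obtain ⟨i, rfl⟩ := (hℬ e).1 he
    refine ⟨i, fun a ha => ?_⟩
    have h1 : min (d x a) (ENNReal.ofReal (c + 2 * ε)) ≤ ENNReal.ofReal (c + ε) := by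
      rw [ENNReal.ofReal_add hc.le hε.le, ENNReal.ofReal_eq_coe_nnreal hε.le,
        ENNReal.ofReal_eq_coe_nnreal (by positivity : 0 ≤ c + 2 * ε)]
      exact (h x a).trans (add_le_add_left ha.le _)
    refine (min_le_iff.1 h1).resolve_right ?_
    rw [ENNReal.ofReal_le_ofReal_iff (by positivity)]
    linarith
  · refine iSup_le fun i => ?_
    refine le_iSup (fun (d : (UniformGauge.ofBasis ℬ hne hdir).metrics) => ⨅ a ∈ A, d.1 x a)
      ⟨b i, hb i, fun ε ω _ => ⟨b i, (hℬ _).2 ⟨i, rfl⟩, fun x y => ?_⟩⟩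
    exact (min_le_left _ _).trans le_self_add

theorem sInf_le_sInf_add_sInf {S T U : Set ℝ≥0∞} (h : ∀ a ∈ S, ∀ b ∈ T, a + b ∈ U) :
    sInf U ≤ sInf S + sInf T := by
  rw [sInf_eq_iInf' S, sInf_eq_iInf' T]
  exact ENNReal.le_iInf_add_iInf fun a b => sInf_le (h a a.2 b b.2)

section

variable {Ω : Type*} [MeasurableSpace Ω] {P : Measure Ω}
variable {X : Type*} [MetricSpace X] [MeasurableSpace X]

/-! ### The Ky Fan metrics -/

theorem kyFan_le {l ε : ℝ} (hε : 0 < ε) {ξ η : RandomVar Ω X}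
    (h : P {ω | l * ε ≤ dist (ξ.1 ω) (η.1 ω)} < ENNReal.ofReal ε) :
    kyFan P l ξ η ≤ ENNReal.ofReal ε :=
  sInf_le ⟨ε, hε, h, rfl⟩

theorem exists_of_kyFan_lt {l : ℝ} {ξ η : RandomVar Ω X} {c : ℝ≥0∞} (h : kyFan P l ξ η < c) :
    ∃ ε : ℝ, 0 < ε ∧ P {ω | l * ε ≤ dist (ξ.1 ω) (η.1 ω)} < ENNReal.ofReal ε ∧
      ENNReal.ofReal ε < c := by
  obtain ⟨_, ⟨ε, hε, h1, rfl⟩, h2⟩ := sInf_lt_iff.1 h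
  exact ⟨ε, hε, h1, h2⟩

theorem isExtMetric_kyFan {l : ℝ} (hl : 0 < l) :
    IsExtMetric (kyFan P l : RandomVar Ω X → RandomVar Ω X → ℝ≥0∞) where
  refl ξ := by
    refine le_antisymm (ENNReal.le_of_forall_pos_le_add fun ε hε _ => ?_) zero_le
    rw [zero_add, ← ENNReal.ofReal_coe_nnreal]
    have : 0 < (ε : ℝ) := hε
    refine kyFan_le this ?_
    have h0 : {ω | l * (ε : ℝ) ≤ dist (ξ.1 ω) (ξ.1 ω)} = ∅ := by
      ext ω
      simp [not_le.2 (mul_pos hl this)]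
    rw [h0, measure_empty]
    exact ENNReal.ofReal_pos.2 this
  symm ξ η := by simp only [kyFan, dist_comm]
  triangle ξ η ζ := by
    refine sInf_le_sInf_add_sInf ?_
    rintro _ ⟨ε, hε, h1, rfl⟩ _ ⟨ε', hε', h2, rfl⟩
    refine ⟨ε + ε', add_pos hε hε', ?_, (ENNReal.ofReal_add hε.le hε'.le).symm⟩
    rw [ENNReal.ofReal_add hε.le hε'.le]
    refine lt_of_le_of_lt ((measure_mono fun ω hω => ?_).trans (measure_union_le _ _))
      (ENNReal.add_lt_add h1 h2)
    by_contra hc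
    simp only [mem_union, mem_ofPred_eq, not_or, not_le] at hc hω
    linarith [dist_triangle (ξ.1 ω) (η.1 ω) (ζ.1 ω)]

theorem kyFanGauge_toApproach_δ (ξ : RandomVar Ω X) (Γ : Set (RandomVar Ω X)) :
    (kyFanGauge P X).toApproach.δ ξ Γ = ⨆ l : {l : ℝ // 0 < l}, ⨅ η ∈ Γ, kyFan P l.1 ξ η :=
  UniformGauge.toApproach_ofBasis_δ (b := fun l : {l : ℝ // 0 < l} => kyFan P l.1)
    (fun d => by simp) (fun l => isExtMetric_kyFan l.2) _ _ ξ Γ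

theorem convInProbApproach_eq : convInProbApproach P X = (kyFanGauge P X).toApproach := by
  ext ξ Γ
  rw [kyFanGauge_toApproach_δ]
  apply le_antisymm
  · refine iSup_biInf_le_iSup_biInf (φ := fun (a : {a : ℝ // 0 < a}) (η : RandomVar Ω X) =>
      P {ω | a.1 ≤ dist (ξ.1 ω) (η.1 ω)}) (fun a c ε hc hε => ?_) Γ
    refine ⟨⟨a.1 / c, div_pos a.2 hc⟩, fun η hη => ?_⟩
    obtain ⟨t, ht, h1, h2⟩ := exists_of_kyFan_lt hη
    have htc : t < c := (ENNReal.ofReal_lt_ofReal_iff hc).1 h2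
    refine (measure_mono fun ω (hω : a.1 ≤ _) => ?_).trans
      (h1.le.trans (ENNReal.ofReal_le_ofReal (by linarith)))
    refine le_trans ?_ hω
    rw [div_mul_eq_mul_div, div_le_iff₀ hc]
    exact mul_le_mul_of_nonneg_left htc.le a.2.le
  · refine iSup_biInf_le_iSup_biInf (ψ := fun (a : {a : ℝ // 0 < a}) (η : RandomVar Ω X) =>
      P {ω | a.1 ≤ dist (ξ.1 ω) (η.1 ω)}) (fun l c ε hc hε => ?_) Γ
    exact ⟨⟨l.1 * c, mul_pos l.2 hc⟩, fun η hη =>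
      (kyFan_le hc hη).trans (ENNReal.ofReal_le_ofReal (by linarith))⟩

/-! ### The Prokhorov metrics -/

theorem prokhorov_le {l ε : ℝ} (hε : 0 < ε) {ξ η : RandomVar Ω X}
    (h : ∀ A : Set X, MeasurableSet A →
      ξ.law P A ≤ η.law P (Metric.cthickening (l * ε) A) + ENNReal.ofReal ε) :
    prokhorov P l ξ η ≤ ENNReal.ofReal ε :=
  sInf_le ⟨ε, hε, h, rfl⟩

theorem exists_of_prokhorov_lt {l : ℝ} {ξ η : RandomVar Ω X} {c : ℝ≥0∞}
    (h : prokhorov P l ξ η < c) :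
    ∃ ε : ℝ, 0 < ε ∧ (∀ A : Set X, MeasurableSet A →
      ξ.law P A ≤ η.law P (Metric.cthickening (l * ε) A) + ENNReal.ofReal ε) ∧
      ENNReal.ofReal ε < c := by
  obtain ⟨_, ⟨ε, hε, h1, rfl⟩, h2⟩ := sInf_lt_iff.1 h
  exact ⟨ε, hε, h1, h2⟩

instance RandomVar.isProbabilityMeasure_law {X : Type*} [MeasurableSpace X]
    [IsProbabilityMeasure P] (ξ : RandomVar Ω X) : IsProbabilityMeasure (ξ.law P) :=
  Measure.isProbabilityMeasure_map ξ.2.aemeasurable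

/-- The Prokhorov metric is symmetric: a bound for `ℒ(ξ)` at the complement of an enlargement of `A`
gives a bound for `ℒ(η)` at `A`. The enlargement is by slightly more than `l ε`, because points of
`A` may lie at distance exactly `l ε` from the complement of `A^(l ε)`. -/
theorem prokhorov_symm_le [IsProbabilityMeasure P] [BorelSpace X] {l : ℝ} (hl : 0 < l)
    (ξ η : RandomVar Ω X) : prokhorov P l η ξ ≤ prokhorov P l ξ η := by
  refine le_sInf ?_
  rintro _ ⟨ε, hε, h, rfl⟩
  refine ENNReal.le_of_forall_pos_le_add fun t ht _ => ?_
  have ht' : 0 < (t : ℝ) := ht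
  have hεt : 0 < ε + t := add_pos hε ht'
  rw [← ENNReal.ofReal_coe_nnreal, ← ENNReal.ofReal_add hε.le ht'.le]
  refine prokhorov_le hεt fun A hA => ?_
  set B := (Metric.cthickening (l * (ε + t)) A)ᶜ
  have hBm : MeasurableSet (Metric.cthickening (l * (ε + t)) A) :=
    Metric.isClosed_cthickening.measurableSet
  have hsub : Metric.cthickening (l * ε) B ⊆ Aᶜ := by
    intro x hx hxA
    have hlt : l * ε < l * (ε + t) := mul_lt_mul_of_pos_left (by linarith) hl
    obtain ⟨y, hyB, hxy⟩ := Metric.mem_thickening_iff.1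
      (Metric.cthickening_subset_thickening' (mul_pos hl hεt) hlt B hx)
    exact hyB (Metric.mem_cthickening_of_dist_le y x _ A hxA (by rw [dist_comm]; exact hxy.le))
  have h1 : ξ.law P B ≤ η.law P Aᶜ + ENNReal.ofReal ε :=
    (h B hBm.compl).trans (add_le_add_left (measure_mono hsub) _)
  calc η.law P A = 1 - η.law P Aᶜ := by
        rw [← prob_compl_eq_one_sub hA.compl, compl_compl]
    _ ≤ ξ.law P (Metric.cthickening (l * (ε + t)) A) + ENNReal.ofReal ε := by
        rw [tsub_le_iff_right, ← prob_add_prob_compl (μ := ξ.law P) hBm, add_assoc,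
          add_comm (ENNReal.ofReal ε)]
        exact add_le_add_right h1 _
    _ ≤ _ := by gcongr; linarith

theorem isExtMetric_prokhorov [IsProbabilityMeasure P] [BorelSpace X] {l : ℝ} (hl : 0 < l) :
    IsExtMetric (prokhorov P l : RandomVar Ω X → RandomVar Ω X → ℝ≥0∞) where
  refl ξ := by
    refine le_antisymm (ENNReal.le_of_forall_pos_le_add fun ε hε _ => ?_) zero_le
    rw [zero_add, ← ENNReal.ofReal_coe_nnreal]
    exact prokhorov_le hε fun A _ =>
      (measure_mono (Metric.self_subset_cthickening A)).trans le_self_add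
  symm ξ η := le_antisymm (prokhorov_symm_le hl _ _) (prokhorov_symm_le hl _ _)
  triangle ξ η ζ := by
    refine sInf_le_sInf_add_sInf ?_
    rintro _ ⟨ε, hε, h1, rfl⟩ _ ⟨ε', hε', h2, rfl⟩
    refine ⟨ε + ε', add_pos hε hε', fun A hA => ?_, (ENNReal.ofReal_add hε.le hε'.le).symm⟩
    have hsub : Metric.cthickening (l * ε') (Metric.cthickening (l * ε) A) ⊆
        Metric.cthickening (l * (ε + ε')) A := by
      rw [mul_add, add_comm]
      exact Metric.cthickening_cthickening_subset (by positivity) (by positivity) A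
    rw [ENNReal.ofReal_add hε.le hε'.le, add_comm (ENNReal.ofReal ε), ← add_assoc]
    refine (h1 A hA).trans (add_le_add_left ?_ _)
    exact (h2 _ Metric.isClosed_cthickening.measurableSet).trans
      (add_le_add_left (measure_mono hsub) _)

theorem prokhorovGauge_toApproach_δ [IsProbabilityMeasure P] [BorelSpace X] (ξ : RandomVar Ω X)
    (Γ : Set (RandomVar Ω X)) :
    (prokhorovGauge P X).toApproach.δ ξ Γ =
      ⨆ l : {l : ℝ // 0 < l}, ⨅ η ∈ Γ, prokhorov P l.1 ξ η :=
  UniformGauge.toApproach_ofBasis_δ (b := fun l : {l : ℝ // 0 < l} => prokhorov P l.1)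
    (fun d => by simp) (fun l => isExtMetric_prokhorov l.2) _ _ ξ Γ

/-- Replacing `ξ` by `η` moves a point of `A` by `l ε` or more only on the event
`d(ξ, η) ≥ l ε`. -/
theorem prokhorov_le_kyFan [BorelSpace X] (l : ℝ) (ξ η : RandomVar Ω X) :
    prokhorov P l ξ η ≤ kyFan P l ξ η := by
  refine sInf_le_sInf ?_
  rintro _ ⟨ε, hε, h, rfl⟩
  refine ⟨ε, hε, fun A hA => ?_, rfl⟩
  rw [RandomVar.law, RandomVar.law, Measure.map_apply ξ.2 hA,
    Measure.map_apply η.2 Metric.isClosed_cthickening.measurableSet]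
  refine (measure_mono fun ω hω => ?_).trans
    ((measure_union_le _ _).trans (add_le_add_right h.le _))
  by_contra hc
  simp only [mem_union, mem_preimage, mem_ofPred_eq, not_or, not_le] at hc hω
  exact hc.1 (Metric.mem_cthickening_of_dist_le _ (ξ.1 ω) _ A hω
    (by rw [dist_comm]; exact hc.2.le))

/-! ### From Prokhorov bounds to integrals -/

/-- The points around which `g` oscillates little at scale `1 / (n + 1)` exhaust the space, so a
single scale `r` works outside a set of small measure. There the `r`-enlargement of a superlevel
set of `g` stays in a slightly lower superlevel set, and the layer cake formula turns the bound on
sets into a bound on integrals. -/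
theorem eventually_integral_le_of_cthickening [BorelSpace X] (μ : Measure X)
    [IsProbabilityMeasure μ] {g : X → ℝ} (hg : Continuous g) (h0 : ∀ x, 0 ≤ g x)
    (h1 : ∀ x, g x ≤ 1) {ε : ℝ} (hε : 0 < ε) :
    ∀ᶠ r in 𝓝[>] (0 : ℝ), ∀ ν : Measure X, IsProbabilityMeasure ν → ∀ c : ℝ, 0 ≤ c →
      (∀ A, MeasurableSet A → μ A ≤ ν (Metric.cthickening r A) + ENNReal.ofReal c) →
      ∫ x, g x ∂μ ≤ ∫ x, g x ∂ν + (c + ε) := by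
  have hε2 := half_pos hε
  let C : ℕ → Set X := fun n => {x | ∀ y, dist x y < 1 / ((n : ℝ) + 1) → g x ≤ g y + ε / 2}
  have hCclosed : ∀ n, IsClosed (C n) := by
    intro n
    refine isClosed_of_closure_subset fun x hx y hy => ?_
    have hmem : {z | dist z y < 1 / ((n : ℝ) + 1)} ∈ 𝓝 x :=
      (isOpen_lt (continuous_id.dist continuous_const) continuous_const).mem_nhds hy
    have hle : IsClosed {z | g z ≤ g y + ε / 2} := isClosed_le hg continuous_const
    refine hle.closure_subset_iff.2 ?_ (mem_closure_iff_nhds.2 fun t ht => ?_ :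
      x ∈ closure (C n ∩ {z | dist z y < 1 / ((n : ℝ) + 1)}))
    · exact fun z hz => hz.1 y hz.2
    · obtain ⟨z, ⟨hzt, hz⟩, hzC⟩ := mem_closure_iff_nhds.1 hx _ (inter_mem ht hmem)
      exact ⟨z, hzt, hzC, hz⟩
  have hCmono : Monotone C := fun m n hmn x hx y hy => hx y (hy.trans_le (by gcongr))
  have hCunion : ⋂ n, (C n)ᶜ = ∅ := by
    rw [← compl_iUnion, compl_empty_iff, eq_univ_iff_forall]
    intro x
    obtain ⟨δ, hδ, hx⟩ := Metric.continuousAt_iff.1 hg.continuousAt (ε / 2) hε2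
    obtain ⟨n, hn⟩ := exists_nat_one_div_lt hδ
    refine mem_iUnion.2 ⟨n, fun y hy => ?_⟩
    have h := hx (show dist y x < δ by rw [dist_comm]; exact hy.trans hn)
    rw [Real.dist_eq, abs_lt] at h
    linarith
  have hlim := tendsto_measure_iInter_atTop (μ := μ) (s := fun n => (C n)ᶜ)
    (fun n => (hCclosed n).measurableSet.compl.nullMeasurableSet)
    (fun m n hmn => compl_subset_compl.2 (hCmono hmn)) ⟨0, measure_ne_top _ _⟩
  rw [hCunion, measure_empty] at hlim
  obtain ⟨n, hn⟩ := (hlim.eventually_lt_const (ENNReal.ofReal_pos.2 hε2)).exists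
  filter_upwards [Ioo_mem_nhdsGT (show (0 : ℝ) < 1 / ((n : ℝ) + 1) by positivity)]
    with r hr ν _ c hc hA
  have hlevel : ∀ t : ℝ, μ {x | t ≤ g x} ≤
      ν {x | t ≤ g x + ε / 2} + ENNReal.ofReal (c + ε / 2) := by
    intro t
    have hm : MeasurableSet {x | t ≤ g x} := measurableSet_le measurable_const hg.measurable
    calc μ {x | t ≤ g x} ≤ μ ({x | t ≤ g x} ∩ C n) + μ (C n)ᶜ := by
          refine (measure_mono fun x hx => ?_).trans (measure_union_le _ _)
          by_cases hxC : x ∈ C n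
          · exact Or.inl ⟨hx, hxC⟩
          · exact Or.inr hxC
      _ ≤ (ν (Metric.cthickening r ({x | t ≤ g x} ∩ C n)) + ENNReal.ofReal c) +
          ENNReal.ofReal (ε / 2) :=
          add_le_add (hA _ (hm.inter (hCclosed n).measurableSet)) hn.le
      _ ≤ _ := by
          rw [add_assoc, ← ENNReal.ofReal_add hc hε2.le]
          refine add_le_add_left (measure_mono fun y hy => ?_) _
          obtain ⟨x, ⟨hxt, hxC⟩, hxy⟩ := Metric.mem_thickening_iff.1
            (Metric.cthickening_subset_thickening' (hr.1.trans hr.2) hr.2 _ hy)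
          exact (show t ≤ g x from hxt).trans (hxC y (by rwa [dist_comm]))
  have hint : ∀ (ρ : Measure X) [IsProbabilityMeasure ρ], Integrable g ρ := fun ρ _ =>
    Integrable.of_bound hg.measurable.aestronglyMeasurable 1
      (Eventually.of_forall fun x => by rw [Real.norm_of_nonneg (h0 x)]; exact h1 x)
  have hlint : ∫⁻ x, ENNReal.ofReal (g x) ∂μ ≤
      ∫⁻ x, ENNReal.ofReal (g x + ε / 2) ∂ν + ENNReal.ofReal (c + ε / 2) := by
    rw [lintegral_eq_lintegral_meas_le μ (Eventually.of_forall h0) hg.measurable.aemeasurable,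
      lintegral_eq_lintegral_meas_le ν
        (Eventually.of_forall fun x => add_nonneg (h0 x) hε2.le)
        (hg.measurable.add_const _).aemeasurable]
    calc ∫⁻ t in Ioi 0, μ {x | t ≤ g x}
        ≤ ∫⁻ t in Ioi (0 : ℝ), (ν {x | t ≤ g x + ε / 2} +
            (Ioc (0 : ℝ) 1).indicator (fun _ => ENNReal.ofReal (c + ε / 2)) t) := by
          refine setLIntegral_mono' measurableSet_Ioi fun t ht => ?_
          by_cases ht1 : t ≤ 1
          · rw [indicator_of_mem (show t ∈ Ioc (0 : ℝ) 1 from ⟨ht, ht1⟩)]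
            exact hlevel t
          · have : {x | t ≤ g x} = ∅ := by
              ext x
              simpa using (h1 x).trans_lt (not_le.1 ht1)
            simp [this]
      _ ≤ _ := by
          rw [lintegral_add_right _ (measurable_const.indicator measurableSet_Ioc),
            lintegral_indicator measurableSet_Ioc,
            Measure.restrict_restrict measurableSet_Ioc,
            inter_eq_left.2 (fun t ht => ht.1)]
          simp
  have hr2 : 0 ≤ c + ε / 2 := add_nonneg hc hε2.le
  have hintν : ∫ x, (g x + ε / 2) ∂ν = ∫ x, g x ∂ν + ε / 2 := by
    rw [integral_add (hint ν) (integrable_const _)]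
    simp
  rw [← ofReal_integral_eq_lintegral_ofReal (hint μ) (Eventually.of_forall h0),
    ← ofReal_integral_eq_lintegral_ofReal (f := fun x => g x + ε / 2)
      ((hint ν).add (integrable_const _))
      (Eventually.of_forall fun x => add_nonneg (h0 x) hε2.le), hintν,
    ← ENNReal.ofReal_add (add_nonneg (integral_nonneg h0) hε2.le) hr2,
    ENNReal.ofReal_le_ofReal_iff (add_nonneg (add_nonneg (integral_nonneg h0) hε2.le) hr2)]
    at hlint
  linarith

theorem eventually_abs_integral_sub_le_of_cthickening [BorelSpace X] (μ : Measure X)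
    [IsProbabilityMeasure μ] (f : C(X, unitInterval)) {ε : ℝ} (hε : 0 < ε) :
    ∀ᶠ r in 𝓝[>] (0 : ℝ), ∀ ν : Measure X, IsProbabilityMeasure ν → ∀ c : ℝ, 0 ≤ c →
      (∀ A, MeasurableSet A → μ A ≤ ν (Metric.cthickening r A) + ENNReal.ofReal c) →
      |∫ x, (f x : ℝ) ∂μ - ∫ x, (f x : ℝ) ∂ν| ≤ c + ε := by
  have hf : Continuous fun x => (f x : ℝ) := continuous_subtype_val.comp f.continuous
  have hint : ∀ (ρ : Measure X) [IsProbabilityMeasure ρ],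
      ∫ x, (1 - (f x : ℝ)) ∂ρ = 1 - ∫ x, (f x : ℝ) ∂ρ := fun ρ _ => by
    rw [integral_sub (integrable_const _)]
    · simp
    · exact Integrable.of_bound hf.measurable.aestronglyMeasurable 1
        (Eventually.of_forall fun x => by rw [Real.norm_of_nonneg (f x).2.1]; exact (f x).2.2)
  filter_upwards [eventually_integral_le_of_cthickening μ hf (fun x => (f x).2.1)
      (fun x => (f x).2.2) hε,
    eventually_integral_le_of_cthickening μ (g := fun x => 1 - (f x : ℝ))
      (continuous_const.sub hf)
      (fun x => sub_nonneg.2 (f x).2.2) (fun x => sub_le_self _ (f x).2.1) hε]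
    with r hr hr' ν hν c hc hA
  have h1 := hr ν hν c hc hA
  have h2 := hr' ν hν c hc hA
  rw [hint μ, hint ν] at h2
  rw [abs_le]
  constructor <;> linarith

/-! ### From finitely many integrals to Prokhorov bounds -/

/-- The finite family consists of bump functions for the finite unions of small balls, taken among
finitely many balls that carry almost all the mass of `μ`. Up to small mass, a Borel set is
caught between the union of those balls that it meets and its own `r`-enlargement. -/
theorem exists_finset_forall_measure_le_cthickening [TopologicalSpace.SeparableSpace X]
    [BorelSpace X] (μ : Measure X) [IsProbabilityMeasure μ] {r ε : ℝ} (hr : 0 < r) (hε : 0 < ε) :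
    ∃ F : Finset C(X, unitInterval), ∀ ν : Measure X, IsProbabilityMeasure ν → ∀ c : ℝ, 0 ≤ c →
      (∀ f ∈ F, ∫ x, (f x : ℝ) ∂μ ≤ ∫ x, (f x : ℝ) ∂ν + c) →
      ∀ A, μ A ≤ ν (Metric.cthickening r A) + ENNReal.ofReal (c + ε) := by
  classical
  have : Nonempty X := nonempty_of_isProbabilityMeasure μ
  obtain ⟨u, hu⟩ := TopologicalSpace.exists_dense_seq X
  have hr3 : 0 < r / 3 := by positivity
  let V : ℕ → Set X := fun n => ⋃ j ∈ Finset.range n, Metric.ball (u j) (r / 3)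
  have hVopen : ∀ n, IsOpen (V n) := fun n => isOpen_biUnion fun j _ => Metric.isOpen_ball
  have hVmono : Monotone V := fun m n hmn =>
    biUnion_subset_biUnion_left fun j hj => Finset.range_mono hmn hj
  have hVinter : ⋂ n, (V n)ᶜ = ∅ := by
    rw [← compl_iUnion, compl_empty_iff, eq_univ_iff_forall]
    intro x
    obtain ⟨j, hj⟩ := hu.exists_dist_lt x hr3
    exact mem_iUnion.2 ⟨j + 1, mem_biUnion (Finset.mem_coe.2 (Finset.self_mem_range_succ j)) hj⟩
  have hlim := tendsto_measure_iInter_atTop (μ := μ) (s := fun n => (V n)ᶜ)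
    (fun n => (hVopen n).measurableSet.compl.nullMeasurableSet)
    (fun m n hmn => compl_subset_compl.2 (hVmono hmn)) ⟨0, measure_ne_top _ _⟩
  rw [hVinter, measure_empty] at hlim
  obtain ⟨n, hn⟩ := (hlim.eventually_lt_const (ENNReal.ofReal_pos.2 hε)).exists
  let U : Finset ℕ → Set X := fun J => ⋃ j ∈ J, Metric.ball (u j) (r / 3)
  let f : Finset ℕ → C(X, unitInterval) := fun J =>
    ⟨fun x => ⟨(thickenedIndicator hr3 (U J) x : ℝ), NNReal.coe_nonneg _,
      NNReal.coe_le_one.2 (thickenedIndicator_le_one hr3 _ x)⟩, by fun_prop⟩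
  have hint : ∀ J (ρ : Measure X) [IsProbabilityMeasure ρ], Integrable (fun x => (f J x : ℝ)) ρ :=
    fun J ρ _ => Integrable.of_bound
      (continuous_subtype_val.comp (f J).continuous).measurable.aestronglyMeasurable 1
      (Eventually.of_forall fun x => by
        rw [Real.norm_of_nonneg (f J x).2.1]; exact (f J x).2.2)
  refine ⟨(Finset.range n).powerset.image f, fun ν _ c hc h A => ?_⟩
  set J := (Finset.range n).filter fun j => (Metric.ball (u j) (r / 3) ∩ A).Nonempty
  have hUm : MeasurableSet (U J) :=
    (isOpen_biUnion fun j _ => Metric.isOpen_ball).measurableSet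
  have hA : A ⊆ U J ∪ (V n)ᶜ := by
    intro x hx
    by_cases hxV : x ∈ V n
    · obtain ⟨j, hj, hxj⟩ := mem_iUnion₂.1 hxV
      exact Or.inl (mem_biUnion (Finset.mem_coe.2 (Finset.mem_filter.2 ⟨hj, x, hxj, hx⟩)) hxj)
    · exact Or.inr hxV
  have hthick : Metric.thickening (r / 3) (U J) ⊆ Metric.cthickening r A := by
    intro x hx
    obtain ⟨y, hy, hxy⟩ := Metric.mem_thickening_iff.1 hx
    obtain ⟨j, hj, hyj⟩ := mem_iUnion₂.1 hy
    obtain ⟨a, haj, haA⟩ := (Finset.mem_filter.1 hj).2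
    refine Metric.mem_cthickening_of_dist_le x a r A haA ?_
    rw [Metric.mem_ball] at hyj haj
    have := dist_triangle x y a
    have := dist_triangle_right y a (u j)
    linarith
  have hlow : μ.real (U J) ≤ ∫ x, (f J x : ℝ) ∂μ := by
    rw [← integral_indicator_one hUm]
    refine integral_mono ((integrable_const (1 : ℝ)).indicator hUm) (hint J μ) fun x => ?_
    by_cases hx : x ∈ U J
    · have h1 : (f J x : ℝ) = 1 := by
        change ((thickenedIndicator hr3 (U J) x : ℝ≥0) : ℝ) = 1
        rw [thickenedIndicator_one hr3 _ hx, NNReal.coe_one]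
      simp [hx, h1]
    · simpa [hx] using (f J x).2.1
  have hup : ∫ x, (f J x : ℝ) ∂ν ≤ ν.real (Metric.cthickening r A) := by
    have hm : MeasurableSet (Metric.cthickening r A) := Metric.isClosed_cthickening.measurableSet
    rw [← integral_indicator_one hm]
    refine integral_mono (hint J ν) ((integrable_const (1 : ℝ)).indicator hm) fun x => ?_
    by_cases hx : x ∈ Metric.cthickening r A
    · simpa [hx] using (f J x).2.2
    · have h0 : (f J x : ℝ) = 0 := by
        change ((thickenedIndicator hr3 (U J) x : ℝ≥0) : ℝ) = 0
        rw [thickenedIndicator_zero hr3 _ fun h => hx (hthick h), NNReal.coe_zero]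
      simp [hx, h0]
  have hmid := h (f J) (Finset.mem_image_of_mem f
    (Finset.mem_powerset.2 (Finset.filter_subset _ _)))
  calc μ A ≤ μ (U J) + μ (V n)ᶜ := (measure_mono hA).trans (measure_union_le _ _)
    _ ≤ ENNReal.ofReal (ν.real (Metric.cthickening r A) + c) + ENNReal.ofReal ε := by
        refine add_le_add ?_ hn.le
        rw [← ofReal_measureReal (measure_ne_top μ (U J))]
        exact ENNReal.ofReal_le_ofReal (by linarith)
    _ = _ := by
        rw [ENNReal.ofReal_add measureReal_nonneg hc, ofReal_measureReal (measure_ne_top ν _), add_assoc,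
          ENNReal.ofReal_add hc hε.le]

/-! ### The weak approach structure -/

theorem weakApproach_eq [IsProbabilityMeasure P] [TopologicalSpace.SeparableSpace X]
    [BorelSpace X] : weakApproach P X = (prokhorovGauge P X).toApproach := by
  ext ξ Γ
  rw [prokhorovGauge_toApproach_δ]
  apply le_antisymm
  · refine iSup_biInf_le_iSup_biInf (φ := fun (F : Finset C(X, unitInterval)) (η : RandomVar Ω X) =>
      ⨆ f ∈ F, ENNReal.ofReal |(∫ x, (f x : ℝ) ∂(ξ.law P)) - ∫ x, (f x : ℝ) ∂(η.law P)|)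
      (fun F c ε hc hε => ?_) Γ
    have hev := (Filter.eventually_all_finset F).2 fun f _ =>
      eventually_abs_integral_sub_le_of_cthickening (ξ.law P) f hε
    obtain ⟨r, hrF, hr⟩ := (hev.and self_mem_nhdsWithin).exists
    refine ⟨⟨r / c, div_pos hr hc⟩, fun η hη => iSup₂_le fun f hf => ?_⟩
    obtain ⟨t, ht, h1, h2⟩ := exists_of_prokhorov_lt hη
    have htc : t < c := (ENNReal.ofReal_lt_ofReal_iff hc).1 h2
    refine ENNReal.ofReal_le_ofReal (hrF f hf (η.law P) inferInstance c hc.le fun A hA =>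
      (h1 A hA).trans (add_le_add (measure_mono (Metric.cthickening_mono ?_ A)) h2.le))
    rw [div_mul_eq_mul_div, div_le_iff₀ hc]
    exact mul_le_mul_of_nonneg_left htc.le (le_of_lt hr)
  · refine iSup_biInf_le_iSup_biInf (ψ := fun (F : Finset C(X, unitInterval)) (η : RandomVar Ω X) =>
      ⨆ f ∈ F, ENNReal.ofReal |(∫ x, (f x : ℝ) ∂(ξ.law P)) - ∫ x, (f x : ℝ) ∂(η.law P)|)
      (fun l c ε hc hε => ?_) Γ
    obtain ⟨F, hF⟩ := exists_finset_forall_measure_le_cthickening (ξ.law P)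
      (mul_pos l.2 (add_pos hc hε)) hε
    refine ⟨F, fun η hη => prokhorov_le (add_pos hc hε) fun A _ =>
      hF (η.law P) inferInstance c hc.le (fun f hf => ?_) A⟩
    have h1 := (le_iSup₂ (f := fun f (_ : f ∈ F) => ENNReal.ofReal
      |(∫ x, (f x : ℝ) ∂(ξ.law P)) - ∫ x, (f x : ℝ) ∂(η.law P)|) f hf).trans_lt hη
    have h2 := (ENNReal.ofReal_lt_ofReal_iff hc).1 h1
    linarith [le_abs_self ((∫ x, (f x : ℝ) ∂(ξ.law P)) - ∫ x, (f x : ℝ) ∂(η.law P))]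

theorem weakApproach_δ_le_convInProbApproach_δ [IsProbabilityMeasure P]
    [TopologicalSpace.SeparableSpace X] [BorelSpace X] (ξ : RandomVar Ω X)
    (Γ : Set (RandomVar Ω X)) :
    (weakApproach P X).δ ξ Γ ≤ (convInProbApproach P X).δ ξ Γ := by
  rw [weakApproach_eq, convInProbApproach_eq, prokhorovGauge_toApproach_δ,
    kyFanGauge_toApproach_δ]
  exact iSup_mono fun l => iInf₂_mono fun η _ => prokhorov_le_kyFan l.1 ξ η

theorem weakApproach_δ_image_congr {ι : Type*} {ξ ξ' : RandomVar Ω X} {u u' : ι → RandomVar Ω X}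
    (h : ξ'.law P = ξ.law P) (hu : ∀ i, (u' i).law P = (u i).law P) (N : Set ι) :
    (weakApproach P X).δ ξ' (u' '' N) = (weakApproach P X).δ ξ (u '' N) := by
  simp only [weakApproach, ApproachStructure.ofFamily, iInf_image, h, hu]

end

theorem ApproachStructure.δ_anti {E : Type*} (𝒜 : ApproachStructure E) (x : E) {A B : Set E}
    (h : A ⊆ B) : 𝒜.δ x B ≤ 𝒜.δ x A := by
  rw [← union_eq_self_of_subset_left h, 𝒜.δ_union]
  exact min_le_left _ _

/-! ### The inequality between the limit operators -/

theorem corollary3p12 {Ω : Type*} [MeasurableSpace Ω] (P : Measure Ω) [IsProbabilityMeasure P]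
    {X : Type*} [MetricSpace X] [CompleteSpace X] [TopologicalSpace.SeparableSpace X]
    [MeasurableSpace X] [BorelSpace X] :
    (∀ (ξ : RandomVar Ω X) (ξs : ℕ → RandomVar Ω X),
      (weakApproach P X).seqLimitOp ξs ξ ≤
        ⨅ (ξ' : RandomVar Ω X) (ξs' : ℕ → RandomVar Ω X)
          (_ : ξ'.law P = ξ.law P) (_ : ∀ n, (ξs' n).law P = (ξs n).law P),
          (convInProbApproach P X).seqLimitOp ξs' ξ') ∧
    convInProbApproach P X = (kyFanGauge P X).toApproach ∧
    weakApproach P X = (prokhorovGauge P X).toApproach := by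
  refine ⟨fun ξ ξs => ?_, convInProbApproach_eq, weakApproach_eq⟩
  refine le_iInf fun ξ' => le_iInf fun ξs' => le_iInf fun h => le_iInf fun hs => ?_
  refine iSup₂_le fun A hA => ?_
  -- The indices `n` with `ξs n ∈ A` carry `A` over to a set of variables of the second sequence.
  set N := ξs ⁻¹' A
  have hmeet : ∀ F ∈ Filter.map ξs' atTop, ((ξs' '' N) ∩ F).Nonempty := by
    intro F hF
    obtain ⟨_, hyA, n, hnF, rfl⟩ := hA (ξs '' (ξs' ⁻¹' F)) (Filter.image_mem_map hF)
    exact ⟨ξs' n, ⟨n, hyA, rfl⟩, hnF⟩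
  calc (weakApproach P X).δ ξ A ≤ (weakApproach P X).δ ξ (ξs '' N) :=
        (weakApproach P X).δ_anti ξ (image_preimage_subset ξs A)
    _ = (weakApproach P X).δ ξ' (ξs' '' N) := (weakApproach_δ_image_congr h hs N).symm
    _ ≤ (convInProbApproach P X).δ ξ' (ξs' '' N) := weakApproach_δ_le_convInProbApproach_δ ξ' _
    _ ≤ _ := le_iSup₂ (f := fun (A : Set (RandomVar Ω X))
        (_ : ∀ F ∈ Filter.map ξs' atTop, (A ∩ F).Nonempty) => (convInProbApproach P X).δ ξ' A)
        (ξs' '' N) hmeet
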